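/- Let $d\in\{2,3\}$, $T>0$, $k\in\mathbb R$ with $k>d/2$, and let $a,b,c,L_1,L_2,L_3,L_4\in\mathbb R$ with $b\ge 0$, $c>0$. Let $Q\in C([0,T];H^k(\mathbb R^d))$ take values in the $Q$-tensors (symmetric traceless real $d\times d$ matrices), $Q(t,\cdot)$ being identified with its continuous representative, and let $Q$ solve on $\mathbb R^d$, in the sense of distributions and with $Q(0,\cdot)=Q_0$, the $L^2$ gradient flow of the Landau–de Gennes energy (summation over repeated indices) $$\begin{aligned}\partial_tQ_{ij}={}&2L_1\Delta Q_{ij}+(L_2+L_3)\big(\partial_j\partial_kQ_{ik}+\partial_i\partial_kQ_{jk}\big)-\tfrac2d(L_2+L_3)\,\partial_l\partial_kQ_{lk}\,\delta_{ij}\\&+2L_4\,\partial_lQ_{ij}\,\partial_kQ_{lk}+2L_4\,\partial_l\partial_kQ_{ij}\,Q_{lk}-L_4\,\partial_iQ_{kl}\,\partial_jQ_{kl}+\tfrac{L_4}{d}|\nabla Q|^2\delta_{ij}\\&-aQ_{ij}+b\big(Q_{ik}Q_{kj}-\tfrac1d\operatorname{tr}(Q^2)\delta_{ij}\big)-c\operatorname{tr}(Q^2)Q_{ij}.\end{aligned}$$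 (When $d=2$ the term with $b$ vanishes.) Assume one of the following: * $d=2$, $L_1\ne0$, $L_4=0$, $L_1+L_2>0$, $L_1+L_3>0$, and $I=\Big[-\sqrt{\tfrac{|a|}{2c}},\ \sqrt{\tfrac{|a|}{2c}}\Big]$; * $d=3$, $L_1>0$, $L_2+L_3=0$, $L_4=0$, $|a|<\dfrac{b^2}{3c}$, $b^2-24ac\ge0$, and $I=\Big[-\dfrac{b+\sqrt{b^2-24ac}}{12c},\ \dfrac{b+\sqrt{b^2-24ac}}{6c}\Big]$. If for every $x\in\mathbb R^d$ all eigenvalues of $Q_0(x)$ lie in $I$, then for every $t\in[0,T]$ and every $x\in\mathbb R^d$ all eigenvalues of $Q(t,x)$ lie in $I$. -/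

import Mathlib

open MeasureTheory
open scoped SchwartzMap ContDiff

/-- The Euclidean space `ℝ^d`. -/
abbrev Space (d : ℕ) : Type := EuclideanSpace ℝ (Fin d)

/-- A `Q`-tensor: a symmetric traceless real `d × d` matrix. -/
def IsQTensor {d : ℕ} (M : Matrix (Fin d) (Fin d) ℝ) : Prop :=
  M.IsSymm ∧ M.trace = 0

/-- All (real) eigenvalues of `M` lie in `I`. -/
def EigenvaluesIn {d : ℕ} (M : Matrix (Fin d) (Fin d) ℝ) (I : Set ℝ) : Prop :=
  ∀ μ : ℝ, Module.End.HasEigenvalue (Matrix.toLin' M) μ → μ ∈ I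

/-- The classical partial derivative `∂_k f`. -/
noncomputable def pderivAt {d : ℕ} (k : Fin d) (f : Space d → ℝ) : Space d → ℝ :=
  fun x => fderiv ℝ f x (EuclideanSpace.single k 1)

/-- Real-valued test functions `φ ∈ C_c^∞(ℝ^d)`. -/
def IsTestFunction {d : ℕ} (φ : Space d → ℝ) : Prop :=
  ContDiff ℝ ∞ φ ∧ HasCompactSupport φ

/-- `g ∈ L²(ℝ^d)` is the weak partial derivative `∂_l f`. -/
def IsWeakPartial {d : ℕ} (l : Fin d) (f g : Space d → ℝ) : Prop :=
  MemLp g 2 volume ∧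
    ∀ φ : Space d → ℝ, IsTestFunction φ →
      ∫ x, f x * pderivAt l φ x = - ∫ x, g x * φ x

/-- `u ∈ C([0,T]; H^k(ℝ^d))` for a scalar real-valued function `u` of time and space and `0 ≤ k`.
For each `t ∈ [0,T]`, `u(t,·)` represents an element `U t` of `L²`, the Bessel potential of order
`k` maps it to an element `V t` of `L²` (that is, `u(t,·) ∈ H^k`, with norm `‖V t‖`), and
`t ↦ V t ∈ L²` is continuous (that is, `t ↦ u(t,·)` is continuous for the norm of `H^k`). -/
def ContinuousInSobolev {d : ℕ} (k T : ℝ) (u : ℝ → Space d → ℝ) : Prop :=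
  ∃ U V : ℝ → Lp ℂ 2 (volume : Measure (Space d)),
    ContinuousOn V (Set.Icc 0 T) ∧
    ∀ t ∈ Set.Icc 0 T,
      (U t : Space d → ℂ) =ᵐ[volume] (fun x => (u t x : ℂ)) ∧
      TemperedDistribution.besselPotential (Space d) ℂ k (U t : 𝓢'(Space d, ℂ)) =
        (V t : 𝓢'(Space d, ℂ))

/-- The elastic and bulk coefficients of the Landau-de Gennes energy. -/
structure Coefficients where
  a : ℝ
  b : ℝ
  c : ℝ
  L₁ : ℝ
  L₂ : ℝ
  L₃ : ℝ
  L₄ : ℝ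

/-- The bulk term
`-a Q_ij + b (Q_ik Q_kj - (1/d) tr(Q²) δ_ij) - c tr(Q²) Q_ij`, as a matrix. -/
noncomputable def bulkTerm {d : ℕ} (C : Coefficients) (M : Matrix (Fin d) (Fin d) ℝ) :
    Matrix (Fin d) (Fin d) ℝ :=
  -(C.a • M) + C.b • (M * M - ((M * M).trace / d) • (1 : Matrix (Fin d) (Fin d) ℝ))
    - (C.c * (M * M).trace) • M

/-- The part of the right-hand side of the `(i,j)` equation that is linear with constant
coefficients and of second order,
`2 L₁ Δ Q_ij + (L₂+L₃)(∂_j ∂_k Q_ik + ∂_i ∂_k Q_jk) - (2/d)(L₂+L₃) ∂_l ∂_k Q_lk δ_ij`,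
paired with `φ`, all derivatives being moved to the test function: this is the integrand at `x`. -/
noncomputable def linearElasticPairing {d : ℕ} (C : Coefficients)
    (q : Space d → Matrix (Fin d) (Fin d) ℝ) (i j : Fin d) (φ : Space d → ℝ) (x : Space d) : ℝ :=
  2 * C.L₁ * q x i j * (∑ k, pderivAt k (pderivAt k φ) x)
  + (C.L₂ + C.L₃) * (∑ k, (q x i k * pderivAt j (pderivAt k φ) x
                          + q x j k * pderivAt i (pderivAt k φ) x))
  - (2 / d) * (C.L₂ + C.L₃) * (∑ l, ∑ k, q x l k * pderivAt l (pderivAt k φ) x)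
      * (if i = j then 1 else 0)

/-- The part of the right-hand side of the `(i,j)` equation that carries `L₄`,
`2 L₄ ∂_l Q_ij ∂_k Q_lk + 2 L₄ ∂_l ∂_k Q_ij Q_lk - L₄ ∂_i Q_kl ∂_j Q_kl + (L₄/d) |∇Q|² δ_ij`,
paired with `φ`: this is the integrand at `x`. Here `D l` is the weak derivative `∂_l Q`, and the
sum of the first two terms is `2 L₄ ∂_k (Q_lk ∂_l Q_ij)`, of which one derivative is moved to the
test function. -/
noncomputable def cubicElasticPairing {d : ℕ} (C : Coefficients)
    (q : Space d → Matrix (Fin d) (Fin d) ℝ)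
    (D : Fin d → Space d → Matrix (Fin d) (Fin d) ℝ)
    (i j : Fin d) (φ : Space d → ℝ) (x : Space d) : ℝ :=
  C.L₄ * (-2 * (∑ l, ∑ k, q x l k * D l x i j * pderivAt k φ x)
    - (∑ k, ∑ l, D i x k l * D j x k l) * φ x
    + (1 / d) * (∑ m, ∑ k, ∑ l, D m x k l ^ 2) * (if i = j then 1 else 0) * φ x)

/-- `Q ∈ C([0,T]; H^k(ℝ^d))`, with values in the `Q`-tensors, solves on the whole space `ℝ^d` the
`L²` gradient flow of the Landau-de Gennes energy with initial datum `Q₀`: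
`∂_t Q_ij = 2 L₁ Δ Q_ij + (L₂+L₃)(∂_j ∂_k Q_ik + ∂_i ∂_k Q_jk) - (2/d)(L₂+L₃) ∂_l ∂_k Q_lk δ_ij`
`  + 2 L₄ ∂_l Q_ij ∂_k Q_lk + 2 L₄ ∂_l ∂_k Q_ij Q_lk - L₄ ∂_i Q_kl ∂_j Q_kl + (L₄/d) |∇Q|² δ_ij`
`  - a Q_ij + b (Q_ik Q_kj - (1/d) tr(Q²) δ_ij) - c tr(Q²) Q_ij`,
in the sense of distributions in space, integrated in time. (For `d = 2` the term with `b` vanishes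
on `Q`-tensors.) As `k > d/2`, each `Q(t,·)` is taken to be the continuous representative of its
class, so that its values at points are meaningful. -/
structure IsSolution {d : ℕ} (C : Coefficients) (k T : ℝ)
    (Q₀ : Space d → Matrix (Fin d) (Fin d) ℝ)
    (Q : ℝ → Space d → Matrix (Fin d) (Fin d) ℝ) : Prop where
  qTensor : ∀ t ∈ Set.Icc 0 T, ∀ x, IsQTensor (Q t x)
  sobolev : ∀ i j, ContinuousInSobolev k T (fun t x => Q t x i j)
  continuous_space : ∀ t ∈ Set.Icc 0 T, Continuous (Q t)
  initial : ∀ x, Q 0 x = Q₀ x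
  equation : ∃ D : ℝ → Fin d → Space d → Matrix (Fin d) (Fin d) ℝ,
    (∀ t ∈ Set.Icc 0 T, ∀ l i j,
      IsWeakPartial l (fun x => Q t x i j) (fun x => D t l x i j)) ∧
    ∀ i j, ∀ φ : Space d → ℝ, IsTestFunction φ → ∀ t ∈ Set.Icc 0 T,
      (∫ x, Q t x i j * φ x) - (∫ x, Q₀ x i j * φ x) =
        ∫ s in (0 : ℝ)..t, ∫ x,
          (linearElasticPairing C (Q s) i j φ x
            + cubicElasticPairing C (Q s) (D s) i j φ x
            + bulkTerm C (Q s x) i j * φ x)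

/-!
Put `m = √(|a| / 2c)` for `d = 2`, and `m = (b + √(b² - 24ac)) / (12c)` for `d = 3`. As the trace of a
`Q`-tensor vanishes, its eigenvalues lie in `I` exactly when its quadratic form is at least `-m`:
a lower bound `-m` on the eigenvalues forces the upper bound `(d - 1) m` (`FormGE.eigenvaluesIn`).
So the claim is that the convex set `{-m ≤ Q}` is invariant under the flow. Two facts make it so.

* The diffusion is scalar. For `d = 3` this is the hypothesis `L₂ + L₃ = 0`; for `d = 2` the mixed
  second order terms collapse, on `Q`-tensors, to `(L₂ + L₃) Δ` (`linearElasticPairing_two`). Hence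
  every `w = v · Q v` solves a heat equation with source `v · f(Q) v`, `f` being the bulk term.
* The bulk term does not point out of the set. Quantitatively, if `-(m + δ) ≤ Q` and `Λ` is large,
  then `Λ Q + f(Q) ≥ -Λ m - Γ δ` (`reaction_lower_bound_two`, `reaction_lower_bound_three`).

Thus a bound `-(m + A e^{2Γt}) ≤ Q`, valid on `[0, T]`, makes `-(m + (A / 2) e^{2Γt})` a subsolution
of the equation `∂_t w - ν Δ w + Λ w = Λ w + v · f(Q) v`, and so improves itself to half the defect
(`lower_bound_improvement`); iterating, the defect vanishes (`IsSolution.formGE`). The comparison is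
made for the mollification of `w` in space: testing the weak equation with translates of the
mollifier shows that it is a classical solution, to which the maximum principle on the whole space
(`nonneg_of_parabolic_supersolution`) applies.

The argument needs `Q` to be bounded and jointly continuous. This is Sobolev's embedding for
`k > d/2` (`ContinuousInSobolev.exists_modulus`), obtained by duality: `J^{-k}` maps `L¹` to `L²`,
because the symbol `(1 + |ξ|²)^{-k/2}` is square integrable.
-/

/-! ### Test functions and mollifiers -/

/-- A bump function equal to one near the origin and supported in the ball of radius `2 / (n + 1)`;
divided by its integral, it serves as mollifier. -/
noncomputable def bumpSeq (d n : ℕ) : ContDiffBump (0 : Space d) :=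
  ⟨1 / (n + 1), 2 / (n + 1), by positivity, by gcongr; norm_num⟩

open Filter Topology in
theorem tendsto_bumpSeq_rOut (d : ℕ) :
    Tendsto (fun n => (bumpSeq d n).rOut) atTop (𝓝 0) := by
  have := (tendsto_one_div_add_atTop_nhds_zero_nat (𝕜 := ℝ)).const_mul 2
  simp only [mul_zero] at this
  refine this.congr fun n => ?_
  simp only [bumpSeq]
  ring

theorem IsTestFunction.comp_sub {d : ℕ} {φ : Space d → ℝ} (hφ : IsTestFunction φ) (x : Space d) :
    IsTestFunction fun y => φ (x - y) :=
  ⟨hφ.1.comp (contDiff_const.sub contDiff_id), hφ.2.comp_homeomorph (Homeomorph.subLeft x)⟩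

theorem IsTestFunction.integrable_mul {d : ℕ} {f φ : Space d → ℝ} (hφ : IsTestFunction φ)
    (hf : Continuous f) : Integrable fun x => f x * φ x :=
  (hf.mul hφ.1.continuous).integrable_of_hasCompactSupport hφ.2.mul_left

theorem isTestFunction_bumpSeq (d n : ℕ) : IsTestFunction ((bumpSeq d n).normed volume) :=
  ⟨(bumpSeq d n).contDiff_normed, (bumpSeq d n).hasCompactSupport_normed⟩

open Filter Topology in
/-- A continuous function is the pointwise limit of its mollifications. -/
theorem tendsto_integral_mul_bumpSeq {d : ℕ} {f : Space d → ℝ} (hf : Continuous f) (x : Space d) :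
    Tendsto (fun n => ∫ y, f y * (bumpSeq d n).normed volume (x - y)) atTop (𝓝 (f x)) := by
  refine (ContDiffBump.convolution_tendsto_right_of_continuous (μ := volume)
    (tendsto_bumpSeq_rOut d) hf x).congr fun n => ?_
  rw [convolution_lsmul_swap]
  simp [mul_comm]

theorem integral_bumpSeq_comp_sub (d n : ℕ) (x : Space d) :
    ∫ y, (bumpSeq d n).normed volume (x - y) = 1 := by
  rw [integral_sub_left_eq_self (fun y => (bumpSeq d n).normed volume y)]
  exact (bumpSeq d n).integral_normed

/-- A continuous function whose pairings with test functions are bounded by `c` times their `L¹`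
norm is bounded by `c`. -/
theorem abs_le_of_forall_abs_integral_mul_le {d : ℕ} {f : Space d → ℝ} (hf : Continuous f) {c : ℝ}
    (h : ∀ φ : Space d → ℝ, IsTestFunction φ → |∫ x, f x * φ x| ≤ c * ∫ x, |φ x|) (x : Space d) :
    |f x| ≤ c := by
  refine le_of_tendsto (tendsto_integral_mul_bumpSeq hf x).abs (Filter.Eventually.of_forall ?_)
  intro n
  refine (h _ ((isTestFunction_bumpSeq d n).comp_sub x)).trans (le_of_eq ?_)
  simp_rw [abs_of_nonneg ((bumpSeq d n).nonneg_normed _)]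
  rw [integral_bumpSeq_comp_sub, mul_one]

/-! ### Sobolev's embedding -/

open Filter Topology FourierTransform in
/-- Sobolev's inequality in dual form: for `k > d/2`, the distribution `J^{-k} V` with `V ∈ L²` acts
on Schwartz functions as a functional bounded for the `L¹` norm, because its Fourier symbol
`(1 + |ξ|²)^{-k/2}` lies in `L²`. -/
theorem exists_norm_besselPotential_neg_apply_le {d : ℕ} {k : ℝ} (hk : (d : ℝ) / 2 < k) :
    ∃ W : ℝ, 0 ≤ W ∧ ∀ (V : Lp ℂ 2 (volume : Measure (Space d))) (φ : 𝓢(Space d, ℂ)),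
      ‖TemperedDistribution.besselPotential (Space d) ℂ (-k) (V : 𝓢'(Space d, ℂ)) φ‖
        ≤ W * ‖V‖ * ∫ x, ‖φ x‖ := by
  set w : Space d → ℝ := fun x => (1 + ‖x‖ ^ 2) ^ (-k / 2) with hw
  have hwsq : ∀ x, (w x) ^ 2 = (1 + ‖x‖ ^ 2) ^ (-(2 * k) / 2) := by
    intro x
    rw [hw, ← Real.rpow_mul_natCast (by positivity)]
    congr 1
    push_cast
    ring
  have hwint : Integrable (fun x => (w x) ^ 2) := by
    simp_rw [hwsq]
    apply integrable_rpow_neg_one_add_norm_sq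
    simp only [finrank_euclideanSpace, Fintype.card_fin]
    linarith
  refine ⟨Real.sqrt (∫ x, (w x) ^ 2), Real.sqrt_nonneg _, fun V φ => ?_⟩
  have hφ0 : 0 ≤ ∫ x, ‖φ x‖ := integral_nonneg fun _ => norm_nonneg _
  set g : 𝓢(Space d, ℂ) :=
    SchwartzMap.smulLeftCLM ℂ (fun x : Space d => ((1 + ‖x‖ ^ 2) ^ (-k / 2) : ℝ)) (𝓕⁻ φ) with hg
  have hgx : ∀ x, ‖g x‖ ≤ w x * ∫ x, ‖φ x‖ := by
    intro x
    have h1 : g x = (w x) • (𝓕⁻ φ) x := by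
      rw [hg, SchwartzMap.smulLeftCLM_apply_apply (by fun_prop)]
    have h2 : ‖(𝓕⁻ φ) x‖ ≤ ∫ x, ‖φ x‖ := by
      rw [SchwartzMap.fourierInv_coe, Real.fourierInv_eq]
      refine (norm_integral_le_integral_norm _).trans (le_of_eq ?_)
      simp
    rw [h1, norm_smul, Real.norm_eq_abs, abs_of_nonneg (by positivity)]
    gcongr
  have hval : TemperedDistribution.besselPotential (Space d) ℂ (-k) (V : 𝓢'(Space d, ℂ)) φ
      = ∫ x, (𝓕 g) x • V x := by
    simp only [TemperedDistribution.besselPotential,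
      TemperedDistribution.fourierMultiplierCLM_apply_apply,
      Lp.toTemperedDistribution_apply]
    congr! 3
    rw [hg, ← SchwartzMap.smulLeftCLM_ofReal ℂ (by fun_prop)]
    rfl
  have hψ2 : ∫ x, ‖(𝓕 g) x‖ ^ 2 ≤ (∫ x, (w x) ^ 2) * (∫ x, ‖φ x‖) ^ 2 := by
    rw [SchwartzMap.integral_norm_sq_fourier, ← integral_mul_const]
    refine integral_mono_of_nonneg (Eventually.of_forall fun x => by positivity)
      (hwint.mul_const _) (Eventually.of_forall fun x => ?_)
    simp only
    rw [← mul_pow]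
    gcongr
    exact hgx x
  have hV : ‖V‖ = Real.sqrt (∫ x, ‖V x‖ ^ 2) := by
    rw [norm_eq_sqrt_re_inner (𝕜 := ℂ), L2.inner_def]
    congr 1
    simp_rw [inner_self_eq_norm_sq_to_K]
    norm_cast
  rw [hval]
  have hH := integral_mul_norm_le_Lp_mul_Lq (μ := (volume : Measure (Space d)))
    (f := fun x => (𝓕 g : 𝓢(Space d, ℂ)) x) (g := V) (p := 2) (q := 2)
    (by constructor <;> norm_num) (by simpa using (𝓕 g).memLp 2) (by simpa using Lp.memLp V)
  have h3 : Real.sqrt (∫ x, ‖(𝓕 g) x‖ ^ 2)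
      ≤ Real.sqrt (∫ x, (w x) ^ 2) * ∫ x, ‖φ x‖ := by
    rw [← Real.sqrt_sq hφ0, ← Real.sqrt_mul (integral_nonneg fun _ => sq_nonneg _)]
    exact Real.sqrt_le_sqrt hψ2
  calc ‖∫ x, (𝓕 g) x • V x‖ ≤ ∫ x, ‖(𝓕 g) x • V x‖ := norm_integral_le_integral_norm _
    _ = ∫ x, ‖(𝓕 g) x‖ * ‖V x‖ := by simp_rw [norm_smul]
    _ ≤ Real.sqrt (∫ x, ‖(𝓕 g) x‖ ^ 2) * ‖V‖ := by
      rw [hV, Real.sqrt_eq_rpow, Real.sqrt_eq_rpow]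
      simpa using hH
    _ ≤ (Real.sqrt (∫ x, (w x) ^ 2) * ∫ x, ‖φ x‖) * ‖V‖ := by gcongr
    _ = _ := by ring

open Filter Topology in
/-- For `k > d/2`, the continuous representatives of an element of `C([0,T]; H^k)` move continuously
in time, uniformly in space. -/
theorem ContinuousInSobolev.exists_modulus {d : ℕ} {k T : ℝ} (hk : (d : ℝ) / 2 < k)
    {u : ℝ → Space d → ℝ} (hu : ContinuousInSobolev k T u)
    (hc : ∀ t ∈ Set.Icc 0 T, Continuous (u t)) :
    (∀ t₀ ∈ Set.Icc 0 T, ∀ ε > 0, ∀ᶠ t in 𝓝[Set.Icc 0 T] t₀, ∀ x, |u t x - u t₀ x| ≤ ε) ∧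
      ∃ R, ∀ t ∈ Set.Icc 0 T, ∀ x, |u t x| ≤ R := by
  obtain ⟨W, hW, hbound⟩ := exists_norm_besselPotential_neg_apply_le hk
  obtain ⟨U, V, hV, hUV⟩ := hu
  have hUV' : ∀ t ∈ Set.Icc 0 T, (U t : 𝓢'(Space d, ℂ)) =
      TemperedDistribution.besselPotential (Space d) ℂ (-k) (V t : 𝓢'(Space d, ℂ)) := fun t ht =>
    ((TemperedDistribution.besselPotential_neg_apply_eq_iff k _ _).2 (hUV t ht).2).symm
  have hpair : ∀ t ∈ Set.Icc 0 T, ∀ φ : 𝓢(Space d, ℂ),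
      (U t : 𝓢'(Space d, ℂ)) φ = ∫ x, φ x * (u t x : ℂ) := by
    intro t ht φ
    rw [Lp.toTemperedDistribution_apply]
    refine integral_congr_ae ?_
    filter_upwards [(hUV t ht).1] with x hx
    rw [hx, smul_eq_mul]
  -- a real test function, regarded as a complex Schwartz function
  have hschw : ∀ φ : Space d → ℝ, IsTestFunction φ → ∃ ψ : 𝓢(Space d, ℂ), ∀ x, ψ x = (φ x : ℂ) := by
    intro φ hφ
    have h1 : ContDiff ℝ ∞ (fun x => (φ x : ℂ)) := Complex.ofRealCLM.contDiff.comp hφ.1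
    have h2 : HasCompactSupport (fun x => (φ x : ℂ)) := hφ.2.comp_left (g := fun r : ℝ => (r : ℂ)) rfl
    exact ⟨h2.toSchwartzMap h1, fun x => rfl⟩
  have hdiff : ∀ t ∈ Set.Icc 0 T, ∀ s ∈ Set.Icc 0 T, ∀ x,
      |u t x - u s x| ≤ W * ‖V t - V s‖ := by
    intro t ht s hs x
    refine abs_le_of_forall_abs_integral_mul_le (f := fun x => u t x - u s x)
      ((hc t ht).sub (hc s hs)) (fun φ hφ => ?_) x
    obtain ⟨ψ, hψ⟩ := hschw φ hφ
    have h := hbound (V t - V s) ψ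
    have e1 : TemperedDistribution.besselPotential (Space d) ℂ (-k)
        ((V t - V s : Lp ℂ 2 (volume : Measure (Space d))) : 𝓢'(Space d, ℂ)) ψ =
        ((∫ x, (u t x - u s x) * φ x : ℝ) : ℂ) := by
      rw [← Lp.toTemperedDistributionCLM_apply, map_sub, map_sub,
        Lp.toTemperedDistributionCLM_apply, Lp.toTemperedDistributionCLM_apply,
        ← hUV' t ht, ← hUV' s hs]
      simp_rw [sub_mul]
      rw [integral_sub (hφ.integrable_mul (hc t ht)) (hφ.integrable_mul (hc s hs))]
      change (U t : 𝓢'(Space d, ℂ)) ψ - (U s : 𝓢'(Space d, ℂ)) ψ = _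
      rw [hpair t ht, hpair s hs]
      simp_rw [hψ]
      rw [Complex.ofReal_sub, ← integral_complex_ofReal, ← integral_complex_ofReal]
      simp [mul_comm]
    rw [e1, Complex.norm_real] at h
    simp_rw [hψ, Complex.norm_real] at h
    exact h
  have hsing : ∀ t ∈ Set.Icc 0 T, ∀ x, |u t x| ≤ W * ‖V t‖ := by
    intro t ht x
    refine abs_le_of_forall_abs_integral_mul_le (hc t ht) (fun φ hφ => ?_) x
    obtain ⟨ψ, hψ⟩ := hschw φ hφ
    have h := hbound (V t) ψ
    rw [← hUV' t ht, hpair t ht] at h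
    have e : ∫ x, ψ x * (u t x : ℂ) = ((∫ x, u t x * φ x : ℝ) : ℂ) := by
      rw [← integral_complex_ofReal]
      simp [hψ, mul_comm]
    rw [e, Complex.norm_real] at h
    simp_rw [hψ, Complex.norm_real] at h
    exact h
  refine ⟨fun t₀ ht₀ ε hε => ?_, ?_⟩
  · have h1 : Tendsto (fun t => W * ‖V t - V t₀‖) (𝓝[Set.Icc 0 T] t₀) (𝓝 0) := by
      have := ((Filter.Tendsto.sub (hV t₀ ht₀)
        (tendsto_const_nhds (x := V t₀))).norm.const_mul W)
      rwa [sub_self, norm_zero, mul_zero] at this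
    filter_upwards [h1.eventually_le_const hε, self_mem_nhdsWithin] with t h2 ht x
    exact (hdiff t ht t₀ ht₀ x).trans h2
  · obtain ⟨R, hR⟩ := isCompact_Icc.exists_bound_of_continuousOn hV
    exact ⟨W * R, fun t ht x => (hsing t ht x).trans (by gcongr; exact hR t ht)⟩

open Set Filter Topology in
theorem continuousOn_uncurry_of_uniform {d : ℕ} {T : ℝ} {u : ℝ → Space d → ℝ}
    (hu : ∀ t₀ ∈ Icc 0 T, ∀ ε > 0, ∀ᶠ t in 𝓝[Icc 0 T] t₀, ∀ x, |u t x - u t₀ x| ≤ ε)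
    (hc : ∀ t ∈ Icc 0 T, Continuous (u t)) :
    ContinuousOn (fun p : ℝ × Space d => u p.1 p.2) (Icc 0 T ×ˢ univ) := by
  rintro ⟨t₀, x₀⟩ ⟨ht₀, -⟩
  rw [ContinuousWithinAt, nhdsWithin_prod_eq, nhdsWithin_univ, Metric.tendsto_nhds]
  intro ε hε
  filter_upwards [(hu t₀ ht₀ (ε / 2) (by positivity)).prod_mk
    (Metric.tendsto_nhds.1 ((hc t₀ ht₀).tendsto x₀) (ε / 2) (by positivity))] with p hp
  calc dist (u p.1 p.2) (u t₀ x₀) ≤ dist (u p.1 p.2) (u t₀ p.2) + dist (u t₀ p.2) (u t₀ x₀) :=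
        dist_triangle _ _ _
    _ < ε / 2 + ε / 2 := add_lt_add_of_le_of_lt (hp.1 p.2) hp.2
    _ = ε := add_halves ε

/-! ### The maximum principle on the whole space -/

theorem hasDerivAt_comp_add_smul_single {d : ℕ} {f : Space d → ℝ} (hf : Differentiable ℝ f)
    (i : Fin d) (x : Space d) (r : ℝ) :
    HasDerivAt (fun r : ℝ => f (x + r • EuclideanSpace.single i 1))
      (pderivAt i f (x + r • EuclideanSpace.single i 1)) r := by
  have h1 : HasDerivAt (fun r : ℝ => x + r • (EuclideanSpace.single i 1 : Space d))
      (EuclideanSpace.single i 1) r := by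
    simpa using ((hasDerivAt_id r).smul_const (EuclideanSpace.single i 1 : Space d)).const_add x
  exact (hf _).hasFDerivAt.comp_hasDerivAt r h1

theorem ContDiff.pderivAt {d : ℕ} {f : Space d → ℝ} {m n : WithTop ℕ∞} (hf : ContDiff ℝ n f)
    (hmn : m + 1 ≤ n) (i : Fin d) : ContDiff ℝ m (pderivAt i f) :=
  (hf.fderiv_right hmn).clm_apply contDiff_const

theorem pderivAt_add {d : ℕ} {f g : Space d → ℝ} (hf : Differentiable ℝ f)
    (hg : Differentiable ℝ g) (i : Fin d) :
    pderivAt i (fun x => f x + g x) = fun x => pderivAt i f x + pderivAt i g x := by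
  ext x
  simp only [pderivAt]
  rw [fderiv_fun_add (hf x) (hg x)]
  rfl

theorem pderivAt_pderivAt_mul_normSq_add {d : ℕ} (η K : ℝ) (i : Fin d) (x : Space d) :
    pderivAt i (pderivAt i (fun x : Space d => η * (‖x‖ ^ 2 + K))) x = 2 * η := by
  have h1 : pderivAt i (fun x : Space d => η * (‖x‖ ^ 2 + K)) = fun x => 2 * η * x i := by
    ext y
    have h : HasFDerivAt (fun x : Space d => η * (‖x‖ ^ 2 + K))
        (η • ((2 : ℕ) • innerSL ℝ y)) y :=
      (((hasStrictFDerivAt_norm_sq y).hasFDerivAt).add_const K).const_mul η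
    simp only [pderivAt, h.fderiv]
    simp [EuclideanSpace.inner_single_right]
    ring
  have h2 : HasFDerivAt (fun x : Space d => 2 * η * x i)
      ((2 * η) • (EuclideanSpace.proj i : Space d →L[ℝ] ℝ)) x :=
    (EuclideanSpace.proj i : Space d →L[ℝ] ℝ).hasFDerivAt.const_mul (2 * η)
  rw [h1]
  simp only [pderivAt, h2.fderiv]
  simp

open Filter Topology in
/-- The necessary second order condition at a minimum, in a coordinate direction. -/
theorem IsLocalMin.pderivAt_pderivAt_nonneg {d : ℕ} {f : Space d → ℝ} {x : Space d}
    (h : IsLocalMin f x) (hf : ContDiff ℝ 2 f) (i : Fin d) :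
    0 ≤ pderivAt i (pderivAt i f) x := by
  by_contra! hneg
  set p : ℝ → ℝ := fun r => f (x + r • EuclideanSpace.single i 1) with hp
  have hd1 : deriv p = fun r => pderivAt i f (x + r • EuclideanSpace.single i 1) := funext fun r =>
    (hasDerivAt_comp_add_smul_single (hf.differentiable (by norm_num)) i x r).deriv
  have hd2 : deriv (deriv p) 0 = pderivAt i (pderivAt i f) x := by
    have := (hasDerivAt_comp_add_smul_single ((hf.pderivAt (m := 1) (by norm_num) i).differentiable
      (by norm_num)) i x 0).deriv
    rw [hd1, this]
    simp
  have hpc : Continuous fun r : ℝ => x + r • (EuclideanSpace.single i 1 : Space d) := by fun_prop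
  have hmin : IsLocalMin p 0 := by
    have h0 : Tendsto (fun r : ℝ => x + r • (EuclideanSpace.single i 1 : Space d)) (𝓝 0) (𝓝 x) := by
      simpa using hpc.tendsto 0
    filter_upwards [h0.eventually h] with r hr
    simpa [hp] using hr
  have hmax : IsLocalMax p 0 := isLocalMax_of_deriv_deriv_neg (by rw [hd2]; exact hneg)
    hmin.deriv_eq_zero (hf.continuous.comp hpc).continuousAt
  -- `p` is both locally maximal and locally minimal at `0`, hence locally constant
  have hconst : p =ᶠ[𝓝 0] fun _ => p 0 := by
    filter_upwards [hmin, hmax] with r h1 h2 using le_antisymm h2 h1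
  have : deriv (deriv p) 0 = 0 := by
    rw [hconst.deriv.deriv_eq]
    simp
  linarith

open Filter Topology in
theorem HasDerivWithinAt.nonpos_of_isMinOn {T t p' : ℝ} {p : ℝ → ℝ} (ht : t ∈ Set.Ioc 0 T)
    (h : HasDerivWithinAt p p' (Set.Icc 0 T) t) (hmin : IsMinOn p (Set.Icc 0 T) t) : p' ≤ 0 := by
  have h1 : HasDerivWithinAt p p' (Set.Ioo 0 t) t :=
    h.mono fun s hs => ⟨hs.1.le, hs.2.le.trans ht.2⟩
  rw [hasDerivWithinAt_iff_tendsto_slope' (by simp)] at h1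
  have : (𝓝[Set.Ioo 0 t] t).NeBot := by
    rw [nhdsWithin_Ioo_eq_nhdsLT ht.1]
    infer_instance
  refine le_of_tendsto h1 ?_
  filter_upwards [self_mem_nhdsWithin] with s hs
  rw [slope_def_field]
  exact div_nonpos_of_nonneg_of_nonpos
    (sub_nonneg.2 (hmin ⟨hs.1.le, hs.2.le.trans ht.2⟩)) (sub_nonpos.2 hs.2.le)

open Set in
/-- The maximum principle for `∂_t - ν Δ + M` on the whole space: a bounded below supersolution
that is nonnegative at time zero stays nonnegative. -/
theorem nonneg_of_parabolic_supersolution {d : ℕ} {T ν M B : ℝ} (hν : 0 ≤ ν) (hM : 0 < M)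
    {z zt : ℝ → Space d → ℝ}
    (hcont : ContinuousOn (fun p : ℝ × Space d => z p.1 p.2) (Icc 0 T ×ˢ univ))
    (hbdd : ∀ t ∈ Icc 0 T, ∀ x, -B ≤ z t x)
    (hz : ∀ t ∈ Icc 0 T, ContDiff ℝ 2 (z t))
    (ht : ∀ t ∈ Icc 0 T, ∀ x, HasDerivWithinAt (fun s => z s x) (zt t x) (Icc 0 T) t)
    (hzero : ∀ x, 0 ≤ z 0 x)
    (hsuper : ∀ t ∈ Icc 0 T, ∀ x,
      0 ≤ zt t x - ν * (∑ i, pderivAt i (pderivAt i (z t)) x) + M * z t x) :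
    ∀ t ∈ Icc 0 T, ∀ x, 0 ≤ z t x := by
  intro t₁ ht₁ x₁
  by_contra! hneg
  -- The penalty `η (‖x‖² + K)` forces the infimum to be attained; the value of `K` makes it a
  -- supersolution, and `η` is so small that the penalized function is still negative somewhere.
  set K : ℝ := 2 * d * ν / M + 1 with hK
  have hKpos : 0 < K := by positivity
  have hMK : 2 * d * ν < M * K := by
    rw [hK, mul_add, mul_div_cancel₀ _ hM.ne']
    linarith
  set η : ℝ := -z t₁ x₁ / (2 * (‖x₁‖ ^ 2 + K)) with hη
  have hηpos : 0 < η := div_pos (by linarith) (by positivity)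
  set pen : Space d → ℝ := fun x => η * (‖x‖ ^ 2 + K) with hpen
  have hpenC : ContDiff ℝ 2 pen := by
    have : ContDiff ℝ 2 (fun x : Space d => ‖x‖ ^ 2) := contDiff_norm_sq ℝ
    exact contDiff_const.mul (this.add contDiff_const)
  have hneg' : z t₁ x₁ + pen x₁ < 0 := by
    have : pen x₁ = -z t₁ x₁ / 2 := by
      simp only [hpen, hη]
      field_simp
    linarith
  set ρ : ℝ := max ‖x₁‖ (|B| / η + 1) with hρ
  have hcomp : IsCompact (Icc 0 T ×ˢ Metric.closedBall (0 : Space d) ρ) :=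
    isCompact_Icc.prod (isCompact_closedBall _ _)
  have hmem : (t₁, x₁) ∈ Icc 0 T ×ˢ Metric.closedBall (0 : Space d) ρ :=
    ⟨ht₁, by simp [hρ]⟩
  obtain ⟨⟨t₀, x₀⟩, h0mem, h0min⟩ := hcomp.exists_isMinOn ⟨_, hmem⟩
    (f := fun p : ℝ × Space d => z p.1 p.2 + pen p.2)
    ((hcont.mono (prod_mono_right (subset_univ _))).add
      (hpenC.continuous.comp continuous_snd).continuousOn)
  have h0neg : z t₀ x₀ + pen x₀ < 0 := (h0min hmem).trans_lt hneg'
  have hglob : ∀ t ∈ Icc 0 T, ∀ x, z t₀ x₀ + pen x₀ ≤ z t x + pen x := by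
    intro t ht x
    by_cases hx : x ∈ Metric.closedBall (0 : Space d) ρ
    · exact h0min (show (t, x) ∈ _ from ⟨ht, hx⟩)
    · have h1 : |B| / η + 1 ≤ ‖x‖ := by
        have h2 : ρ < ‖x‖ := by simpa using hx
        exact (le_max_right _ _).trans h2.le
      have h2 : |B| / η ≤ ‖x‖ ^ 2 := by
        have : 0 ≤ |B| / η := by positivity
        nlinarith
      have h3 : |B| ≤ η * ‖x‖ ^ 2 := by
        rw [div_le_iff₀ hηpos] at h2
        linarith
      have h4 := hbdd t ht x
      have h5 := le_abs_self B
      have h6 : pen x = η * ‖x‖ ^ 2 + η * K := by simp only [hpen]; ring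
      nlinarith [mul_pos hηpos hKpos]
  have ht₀ : t₀ ∈ Icc 0 T := h0mem.1
  have hpen0 : 0 < pen x₀ := by simp only [hpen]; positivity
  have ht₀pos : 0 < t₀ := by
    rcases ht₀.1.eq_or_lt with h | h
    · rw [← h] at h0neg
      linarith [hzero x₀]
    · exact h
  have htime : zt t₀ x₀ ≤ 0 := (ht t₀ ht₀ x₀).nonpos_of_isMinOn ⟨ht₀pos, ht₀.2⟩
    fun s hs => by simpa using hglob s hs x₀
  have hspace : ∀ i, -(2 * η) ≤ pderivAt i (pderivAt i (z t₀)) x₀ := by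
    intro i
    have hmin : IsLocalMin (fun x => z t₀ x + pen x) x₀ :=
      Filter.Eventually.of_forall fun x => hglob t₀ ht₀ x
    have h := hmin.pderivAt_pderivAt_nonneg ((hz t₀ ht₀).add hpenC) i
    have hz1 := (hz t₀ ht₀).pderivAt (m := 1) (by norm_num) i
    have hp1 := hpenC.pderivAt (m := 1) (by norm_num) i
    rw [pderivAt_add ((hz t₀ ht₀).differentiable (by norm_num))
      (hpenC.differentiable (by norm_num)), pderivAt_add (hz1.differentiable (by norm_num))
      (hp1.differentiable (by norm_num))] at h
    have h' : pderivAt i (pderivAt i pen) x₀ = 2 * η := pderivAt_pderivAt_mul_normSq_add η K i x₀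
    linarith
  have hsum : -(2 * η * d) ≤ ∑ i, pderivAt i (pderivAt i (z t₀)) x₀ := by
    have := Finset.sum_le_sum fun i (_ : i ∈ Finset.univ) => hspace i
    simp only [Finset.sum_const, Finset.card_univ, Fintype.card_fin, nsmul_eq_mul] at this
    linarith
  have h1 := hsuper t₀ ht₀ x₀
  have h2 := mul_le_mul_of_nonneg_left hsum hν
  have h3 : M * z t₀ x₀ < -(M * pen x₀) := by nlinarith
  have h4 : η * (M * K) ≤ M * pen x₀ := by
    have : η * K ≤ pen x₀ := by
      simp only [hpen]
      nlinarith [sq_nonneg ‖x₀‖, mul_nonneg hηpos.le (sq_nonneg ‖x₀‖)]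
    nlinarith
  nlinarith [mul_lt_mul_of_pos_left hMK hηpos]

/-! ### Laplacians and mollified equations -/

/-- The Laplacian, as the sum of the iterated classical partial derivatives. -/
noncomputable def laplAt {d : ℕ} (f : Space d → ℝ) : Space d → ℝ :=
  fun x => ∑ k, pderivAt k (pderivAt k f) x

theorem IsTestFunction.pderivAt {d : ℕ} {φ : Space d → ℝ} (hφ : IsTestFunction φ) (k : Fin d) :
    IsTestFunction (pderivAt k φ) :=
  ⟨hφ.1.pderivAt (by simp) k, hφ.2.fderiv_apply ℝ _⟩

theorem IsTestFunction.sum {d : ℕ} {ι : Type*} (s : Finset ι) {φ : ι → Space d → ℝ}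
    (hφ : ∀ i, IsTestFunction (φ i)) : IsTestFunction fun x => ∑ i ∈ s, φ i x := by
  refine ⟨ContDiff.sum fun i _ => (hφ i).1, ?_⟩
  have : (fun x => ∑ i ∈ s, φ i x) = ∑ i ∈ s, φ i := by
    ext x
    simp
  rw [this]
  exact Finset.sum_induction _ HasCompactSupport (fun _ _ => HasCompactSupport.add)
    HasCompactSupport.zero fun i _ => (hφ i).2

theorem IsTestFunction.laplAt {d : ℕ} {φ : Space d → ℝ} (hφ : IsTestFunction φ) :
    IsTestFunction (laplAt φ) :=
  IsTestFunction.sum Finset.univ fun k => (hφ.pderivAt k).pderivAt k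

theorem IsTestFunction.pderivAt_comm {d : ℕ} {φ : Space d → ℝ} (hφ : IsTestFunction φ)
    (i j : Fin d) (x : Space d) :
    _root_.pderivAt i (_root_.pderivAt j φ) x = _root_.pderivAt j (_root_.pderivAt i φ) x := by
  have hφ2 : ContDiff ℝ 2 φ := contDiff_infty.1 hφ.1 2
  have hd : DifferentiableAt ℝ (fderiv ℝ φ) x :=
    ((hφ2.fderiv_right (m := 1) (by norm_num)).differentiable (by simp)) x
  have h : ∀ i j, _root_.pderivAt i (_root_.pderivAt j φ) x =
      fderiv ℝ (fderiv ℝ φ) x (EuclideanSpace.single i 1) (EuclideanSpace.single j 1) := by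
    intro i j
    unfold _root_.pderivAt
    rw [fderiv_clm_apply hd (differentiableAt_const _)]
    simp
  rw [h, h]
  exact (hφ2.contDiffAt.isSymmSndFDerivAt (by simp)).eq _ _

theorem pderivAt_comp_sub {d : ℕ} {f : Space d → ℝ} (hf : Differentiable ℝ f) (k : Fin d)
    (x : Space d) :
    pderivAt k (fun y => f (x - y)) = fun y => -pderivAt k f (x - y) := by
  ext y
  have h := ((hf (x - y)).hasFDerivAt).comp y ((hasFDerivAt_id y).const_sub x)
  simp only [pderivAt]
  change fderiv ℝ (f ∘ HSub.hSub x) y _ = _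
  rw [h.fderiv]
  simp

theorem laplAt_comp_sub {d : ℕ} {φ : Space d → ℝ} (hφ : IsTestFunction φ) (x : Space d) :
    laplAt (fun y => φ (x - y)) = fun y => laplAt φ (x - y) := by
  ext y
  refine Finset.sum_congr rfl fun k _ => ?_
  have hd : Differentiable ℝ (pderivAt k φ) := (hφ.pderivAt k).1.differentiable (by simp)
  have hneg : pderivAt k (fun y => -pderivAt k φ y) = fun y => -pderivAt k (pderivAt k φ) y := by
    ext y
    rw [pderivAt, fderiv_fun_neg]
    rfl
  rw [pderivAt_comp_sub (hφ.1.differentiable (by simp)),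
    pderivAt_comp_sub (f := fun y => -pderivAt k φ y) hd.neg, hneg]
  simp

open Convolution in
theorem mollification_eq_convolution {d : ℕ} (f ρ : Space d → ℝ) :
    (fun x => ∫ y, f y * ρ (x - y)) = f ⋆[ContinuousLinearMap.lsmul ℝ ℝ] ρ := by
  ext x
  simp [convolution_def]

theorem contDiff_mollification {d : ℕ} {f ρ : Space d → ℝ} (hf : Continuous f)
    (hρ : IsTestFunction ρ) (n : ℕ∞) : ContDiff ℝ n (fun x => ∫ y, f y * ρ (x - y)) := by
  rw [mollification_eq_convolution]
  exact hρ.2.contDiff_convolution_right _ hf.locallyIntegrable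
    (hρ.1.of_le (by exact_mod_cast le_top))

theorem pderivAt_mollification {d : ℕ} {f ρ : Space d → ℝ} (hf : Continuous f)
    (hρ : IsTestFunction ρ) (k : Fin d) :
    pderivAt k (fun x => ∫ y, f y * ρ (x - y)) = fun x => ∫ y, f y * pderivAt k ρ (x - y) := by
  rw [mollification_eq_convolution, mollification_eq_convolution]
  ext x
  have hρ1 : ContDiff ℝ 1 ρ := hρ.1.of_le (by exact_mod_cast le_top)
  rw [pderivAt, (hρ.2.hasFDerivAt_convolution_right _ hf.locallyIntegrable hρ1 x).fderiv,
    convolution_precompR_apply _ hf.locallyIntegrable (hρ.2.fderiv ℝ)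
      (hρ1.continuous_fderiv one_ne_zero)]
  rfl

theorem laplAt_mollification {d : ℕ} {f ρ : Space d → ℝ} (hf : Continuous f)
    (hρ : IsTestFunction ρ) (x : Space d) :
    laplAt (fun x => ∫ y, f y * ρ (x - y)) x = ∫ y, f y * laplAt ρ (x - y) := by
  simp only [laplAt]
  simp_rw [pderivAt_mollification hf hρ, pderivAt_mollification hf (hρ.pderivAt _),
    Finset.mul_sum]
  rw [integral_finsetSum]
  exact fun k _ => (((hρ.pderivAt k).pderivAt k).comp_sub x).integrable_mul hf

open Set in
theorem continuousOn_integral_mul_of_isTestFunction {d : ℕ} {T : ℝ} {w : ℝ → Space d → ℝ}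
    (hw : ContinuousOn (fun p : ℝ × Space d => w p.1 p.2) (Icc 0 T ×ˢ univ)) {φ : Space d → ℝ}
    (hφ : IsTestFunction φ) : ContinuousOn (fun t => ∫ y, w t y * φ y) (Icc 0 T) := by
  refine continuousOn_integral_of_compact_support (k := tsupport φ) hφ.2 ?_ ?_
  · exact hw.mul (hφ.1.continuous.comp continuous_snd).continuousOn
  · intro t x _ hx
    simp [image_eq_zero_of_notMem_tsupport hx]

open Set in
theorem continuousOn_mollification {d : ℕ} {T : ℝ} {w : ℝ → Space d → ℝ}
    (hw : ContinuousOn (fun p : ℝ × Space d => w p.1 p.2) (Icc 0 T ×ˢ univ)) {ρ : Space d → ℝ}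
    (hρ : IsTestFunction ρ) :
    ContinuousOn (fun p : ℝ × Space d => ∫ y, w p.1 y * ρ (p.2 - y)) (Icc 0 T ×ˢ univ) := by
  have h : ∀ p : ℝ × Space d, ∫ y, w p.1 y * ρ (p.2 - y) = ∫ y, w p.1 (p.2 - y) * ρ y := by
    intro p
    rw [← integral_sub_left_eq_self _ volume p.2]
    simp
  simp_rw [h]
  refine continuousOn_integral_of_compact_support (k := tsupport ρ) hρ.2 ?_ ?_
  · refine ContinuousOn.mul (hw.comp (f := fun q : (ℝ × Space d) × Space d =>
      (q.1.1, q.1.2 - q.2)) (by fun_prop) ?_) (hρ.1.continuous.comp continuous_snd).continuousOn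
    rintro ⟨⟨t, x⟩, y⟩ hq
    exact ⟨hq.1.1, mem_univ _⟩
  · intro t x _ hx
    simp [image_eq_zero_of_notMem_tsupport hx]

theorem le_integral_mul_of_le {d : ℕ} {f φ : Space d → ℝ} {c : ℝ} (hf : Continuous f)
    (hφ : IsTestFunction φ) (hφ0 : ∀ x, 0 ≤ φ x) (hφ1 : ∫ x, φ x = 1) (h : ∀ x, c ≤ f x) :
    c ≤ ∫ x, f x * φ x := by
  calc c = ∫ x, c * φ x := by rw [integral_const_mul, hφ1, mul_one]
    _ ≤ ∫ x, f x * φ x := integral_mono (hφ.integrable_mul continuous_const)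
        (hφ.integrable_mul hf) fun x => mul_le_mul_of_nonneg_right (h x) (hφ0 x)

open Set Filter Topology in
/-- One step of the barrier argument for a scalar weak solution of `∂_t w = ν Δ w + r`: a lower
bound on `Λ w + r` that deteriorates with the defect `A e^{2Γt}` gives back the lower bound
on `w` with half of that defect. Mollifying in space turns the weak equation into a classical one,
to which the maximum principle applies. -/
theorem lower_bound_improvement {d : ℕ} {T ν Λ Γ m A R : ℝ} (hν : 0 ≤ ν) (hΛ : 0 < Λ)
    (hA : 0 ≤ A) (hm : 0 ≤ m) {w r : ℝ → Space d → ℝ}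
    (hw : ContinuousOn (fun p : ℝ × Space d => w p.1 p.2) (Icc 0 T ×ˢ univ))
    (hr : ContinuousOn (fun p : ℝ × Space d => r p.1 p.2) (Icc 0 T ×ˢ univ))
    (hbdd : ∀ t ∈ Icc 0 T, ∀ x, -R ≤ w t x)
    (heq : ∀ φ : Space d → ℝ, IsTestFunction φ → ∀ t ∈ Icc 0 T,
      (∫ x, w t x * φ x) - ∫ x, w 0 x * φ x =
        ∫ s in (0 : ℝ)..t, ((∫ x, ν * w s x * laplAt φ x) + ∫ x, r s x * φ x))
    (hzero : ∀ x, -m ≤ w 0 x)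
    (hreact : ∀ t ∈ Icc 0 T, ∀ x,
      -(Λ * m) - Γ * (A * Real.exp (2 * Γ * t)) ≤ Λ * w t x + r t x) :
    ∀ t ∈ Icc 0 T, ∀ x, -(m + A / 2 * Real.exp (2 * Γ * t)) ≤ w t x := by
  have hslice : ∀ {u : ℝ → Space d → ℝ},
      ContinuousOn (fun p : ℝ × Space d => u p.1 p.2) (Icc 0 T ×ˢ univ) →
      ∀ t ∈ Icc 0 T, Continuous (u t) := fun {u} hu t ht =>
    continuousOn_univ.1 (hu.comp (f := fun x : Space d => (t, x)) (by fun_prop)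
      fun x _ => ⟨ht, mem_univ _⟩)
  intro t₁ ht₁ x₁
  refine ge_of_tendsto' (tendsto_integral_mul_bumpSeq (hslice hw t₁ ht₁) x₁) fun n => ?_
  set ρ : Space d → ℝ := (bumpSeq d n).normed volume with hρdef
  have hρ : IsTestFunction ρ := isTestFunction_bumpSeq d n
  have hρ0 : ∀ x y, 0 ≤ ρ (x - y) := fun x y => (bumpSeq d n).nonneg_normed _
  have hρ1 : ∀ x, ∫ y, ρ (x - y) = 1 := integral_bumpSeq_comp_sub d n
  set g : ℝ → Space d → ℝ := fun s x =>
    (∫ y, ν * w s y * laplAt ρ (x - y)) + ∫ y, r s y * ρ (x - y) with hg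
  set e : ℝ → ℝ := fun t => m + A / 2 * Real.exp (2 * Γ * t) with he
  have he0 : ∀ t, 0 ≤ e t := fun t => by positivity
  have hgc : ∀ x, ContinuousOn (fun s => g s x) (Icc 0 T) := fun x =>
    (continuousOn_integral_mul_of_isTestFunction (w := fun s y => ν * w s y)
      (continuousOn_const.mul hw) (hρ.laplAt.comp_sub x)).add
      (continuousOn_integral_mul_of_isTestFunction hr (hρ.comp_sub x))
  have hderiv : ∀ t ∈ Icc 0 T, ∀ x,
      HasDerivWithinAt (fun s => ∫ y, w s y * ρ (x - y)) (g t x) (Icc 0 T) t := by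
    intro t ht x
    have : Fact (t ∈ Icc 0 T) := ⟨ht⟩
    have h1 : HasDerivWithinAt (fun u => ∫ s in (0 : ℝ)..u, g s x) (g t x) (Icc 0 T) t := by
      refine intervalIntegral.integral_hasDerivWithinAt_right ?_
        ((hgc x).stronglyMeasurableAtFilter_nhdsWithin measurableSet_Icc t) (hgc x t ht)
      refine ((hgc x).mono ?_).intervalIntegrable
      rw [uIcc_of_le ht.1]
      exact Icc_subset_Icc_right ht.2
    refine (h1.const_add (∫ y, w 0 y * ρ (x - y))).congr_of_mem (fun s hs => ?_) ht
    have h2 := heq _ (hρ.comp_sub x) s hs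
    rw [laplAt_comp_sub hρ] at h2
    simp only [hg]
    linarith
  have hz := nonneg_of_parabolic_supersolution (T := T) (ν := ν) (M := Λ) (B := R) hν hΛ
    (z := fun t x => (∫ y, w t y * ρ (x - y)) + e t)
    (zt := fun t x => g t x + A / 2 * (Real.exp (2 * Γ * t) * (2 * Γ))) ?_ ?_ ?_ ?_ ?_ ?_ t₁ ht₁ x₁
  · simp only [he] at hz
    linarith
  · refine (continuousOn_mollification hw hρ).add (Continuous.continuousOn ?_)
    fun_prop
  · intro t ht x
    have := le_integral_mul_of_le (hslice hw t ht) (hρ.comp_sub x) (hρ0 x) (hρ1 x) (hbdd t ht)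
    linarith [he0 t]
  · intro t ht
    exact (contDiff_mollification (hslice hw t ht) hρ 2).add contDiff_const
  · intro t ht x
    refine (hderiv t ht x).add (HasDerivAt.hasDerivWithinAt ?_)
    have h1 : HasDerivAt (fun t : ℝ => Real.exp (2 * Γ * t)) (Real.exp (2 * Γ * t) * (2 * Γ)) t := by
      simpa using ((hasDerivAt_id t).const_mul (2 * Γ)).exp
    exact (h1.const_mul (A / 2)).const_add m
  · intro x
    have h0 : (0 : ℝ) ∈ Icc 0 T := ⟨le_rfl, ht₁.1.trans ht₁.2⟩
    have h1 := le_integral_mul_of_le (hslice hw 0 h0) (hρ.comp_sub x) (hρ0 x) (hρ1 x) hzero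
    have h2 : 0 ≤ A / 2 * Real.exp (2 * Γ * 0) := by positivity
    simp only [he]
    linarith
  · intro t ht x
    have hlap : ∑ i, pderivAt i (pderivAt i fun x => (∫ y, w t y * ρ (x - y)) + e t) x =
        ∫ y, w t y * laplAt ρ (x - y) := by
      rw [← laplAt_mollification (hslice hw t ht) hρ]
      refine Finset.sum_congr rfl fun i _ => ?_
      congr 1
      ext x
      simp only [pderivAt]
      rw [fderiv_add_const]
    have hsplit : g t x = ν * (∫ y, w t y * laplAt ρ (x - y)) + ∫ y, r t y * ρ (x - y) := by
      simp only [hg]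
      rw [← integral_const_mul]
      simp_rw [mul_assoc]
    have h1 := le_integral_mul_of_le (f := fun y => Λ * w t y + r t y)
      ((continuous_const.mul (hslice hw t ht)).add (hslice hr t ht)) (hρ.comp_sub x) (hρ0 x) (hρ1 x)
      (hreact t ht)
    have h2 : ∫ y, (Λ * w t y + r t y) * ρ (x - y) =
        Λ * (∫ y, w t y * ρ (x - y)) + ∫ y, r t y * ρ (x - y) := by
      rw [← integral_const_mul, ← integral_add]
      · congr 1
        ext y
        ring
      · exact ((hρ.comp_sub x).integrable_mul (hslice hw t ht)).const_mul Λ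
      · exact (hρ.comp_sub x).integrable_mul (hslice hr t ht)
    rw [h2] at h1
    rw [hlap, hsplit]
    have h3 : 0 ≤ Λ * (A / 2 * Real.exp (2 * Γ * t)) := by positivity
    simp only [he]
    linarith

section

open Matrix

/-! ### Quadratic forms of `Q`-tensors and the bulk term -/

/-- The quadratic form of `M` is bounded below by `r` times the Euclidean one, that is, `M - r`
is positive semidefinite. -/
def FormGE {d : ℕ} (r : ℝ) (M : Matrix (Fin d) (Fin d) ℝ) : Prop :=
  ∀ v : Fin d → ℝ, r * (v ⬝ᵥ v) ≤ v ⬝ᵥ (M *ᵥ v)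

theorem FormGE.add_smul_one {d : ℕ} {m : ℝ} {M : Matrix (Fin d) (Fin d) ℝ} (h : FormGE (-m) M) :
    FormGE 0 (M + m • (1 : Matrix (Fin d) (Fin d) ℝ)) := by
  intro v
  have := h v
  simp only [add_mulVec, smul_mulVec, one_mulVec, dotProduct_add, dotProduct_smul, smul_eq_mul]
  linarith

theorem zero_le_dotProduct_self {d : ℕ} (v : Fin d → ℝ) : 0 ≤ v ⬝ᵥ v :=
  Finset.sum_nonneg fun i _ => mul_self_nonneg (v i)

theorem FormGE.of_dotProduct_self_eq_one {d : ℕ} {r : ℝ} {M : Matrix (Fin d) (Fin d) ℝ}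
    (h : ∀ v : Fin d → ℝ, v ⬝ᵥ v = 1 → r ≤ v ⬝ᵥ (M *ᵥ v)) : FormGE r M := by
  intro v
  rcases (zero_le_dotProduct_self v).eq_or_lt with h0 | h0
  · rw [dotProduct_self_eq_zero.1 h0.symm]
    simp
  · have hs : Real.sqrt (v ⬝ᵥ v) ≠ 0 := (Real.sqrt_pos.2 h0).ne'
    have h1 := h ((Real.sqrt (v ⬝ᵥ v))⁻¹ • v) (by
      simp only [smul_dotProduct, dotProduct_smul, smul_eq_mul]
      field_simp
      rw [Real.sq_sqrt h0.le])
    simp only [mulVec_smul, smul_dotProduct, dotProduct_smul, smul_eq_mul] at h1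
    rw [← mul_assoc, ← mul_inv, Real.mul_self_sqrt h0.le, inv_mul_eq_div, le_div_iff₀ h0] at h1
    exact h1

/-- For a symmetric matrix with nonnegative quadratic form, the `2 × 2` minors give
`tr (M²) ≤ (tr M)²`. -/
theorem trace_mul_self_le_sq_trace {d : ℕ} {M : Matrix (Fin d) (Fin d) ℝ} (hs : M.IsSymm)
    (h : FormGE 0 M) : (M * M).trace ≤ M.trace ^ 2 := by
  have hij : ∀ i j, M i j * M j i ≤ M i i * M j j := by
    intro i j
    have hq : ∀ r : ℝ, 0 ≤ M i i * (r * r) + (2 * M i j) * r + M j j := by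
      intro r
      have := h (r • Pi.single i 1 + Pi.single j 1)
      simp only [mulVec_add, mulVec_smul, mulVec_single_one, add_dotProduct, dotProduct_add,
        smul_dotProduct, dotProduct_smul, single_one_dotProduct, smul_eq_mul, zero_mul, col_apply]
        at this
      rw [hs.apply i j] at this
      linarith
    have := discrim_le_zero hq
    rw [discrim] at this
    rw [hs.apply i j]
    nlinarith
  simp only [trace, diag_apply, mul_apply]
  rw [sq, Finset.sum_mul_sum]
  exact Finset.sum_le_sum fun i _ => Finset.sum_le_sum fun j _ => hij i j

theorem dotProduct_mulVec_self_le {d : ℕ} {M : Matrix (Fin d) (Fin d) ℝ} (hs : M.IsSymm)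
    (v : Fin d → ℝ) : (M *ᵥ v) ⬝ᵥ (M *ᵥ v) ≤ (M * M).trace * (v ⬝ᵥ v) := by
  simp only [trace, diag_apply, mul_apply, dotProduct, mulVec]
  rw [Finset.sum_mul]
  refine Finset.sum_le_sum fun i _ => ?_
  have := Finset.sum_mul_sq_le_sq_mul_sq Finset.univ (fun j => M i j) v
  simp_rw [hs.apply i]
  simpa [sq] using this

theorem sq_dotProduct_mulVec_le {d : ℕ} (M : Matrix (Fin d) (Fin d) ℝ) {v : Fin d → ℝ}
    (hv : v ⬝ᵥ v = 1) : (v ⬝ᵥ (M *ᵥ v)) ^ 2 ≤ (M *ᵥ v) ⬝ᵥ (M *ᵥ v) := by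
  have := Finset.sum_mul_sq_le_sq_mul_sq Finset.univ v (M *ᵥ v)
  have hv' : ∑ i, v i ^ 2 = 1 := by simpa [dotProduct, sq] using hv
  rw [hv', one_mul] at this
  simpa [dotProduct, sq] using this

theorem dotProduct_mul_mulVec {d : ℕ} {M : Matrix (Fin d) (Fin d) ℝ} (hs : M.IsSymm)
    (v : Fin d → ℝ) : v ⬝ᵥ ((M * M) *ᵥ v) = (M *ᵥ v) ⬝ᵥ (M *ᵥ v) := by
  rw [← mulVec_mulVec, dotProduct_mulVec, ← mulVec_transpose, hs.eq]

theorem trace_sq_add_smul_one {d : ℕ} {M : Matrix (Fin d) (Fin d) ℝ} (hM : M.trace = 0) (m : ℝ) :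
    ((M + m • (1 : Matrix (Fin d) (Fin d) ℝ)) * (M + m • (1 : Matrix (Fin d) (Fin d) ℝ))).trace =
      (M * M).trace + d * m ^ 2 := by
  simp [add_mul, mul_add, hM]
  ring

theorem isSymm_add_smul_one {d : ℕ} {M : Matrix (Fin d) (Fin d) ℝ} (hM : M.IsSymm) (m : ℝ) :
    (M + m • (1 : Matrix (Fin d) (Fin d) ℝ)).IsSymm :=
  hM.add (isSymm_one.smul m)

theorem IsQTensor.trace_mul_self_le {d : ℕ} {m : ℝ} {M : Matrix (Fin d) (Fin d) ℝ}
    (hM : IsQTensor M) (h : FormGE (-m) M) : (M * M).trace ≤ d * (d - 1) * m ^ 2 := by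
  have h1 := trace_mul_self_le_sq_trace (isSymm_add_smul_one hM.1 m) h.add_smul_one
  rw [trace_sq_add_smul_one hM.2, trace_add, hM.2, trace_smul, trace_one] at h1
  simp only [Fintype.card_fin, smul_eq_mul, zero_add] at h1
  nlinarith

theorem Matrix.IsSymm.trace_mul_self_nonneg {d : ℕ} {M : Matrix (Fin d) (Fin d) ℝ}
    (hM : M.IsSymm) : 0 ≤ (M * M).trace := by
  simp only [trace, diag_apply, mul_apply]
  refine Finset.sum_nonneg fun i _ => Finset.sum_nonneg fun j _ => ?_
  rw [hM.apply i j]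
  exact mul_self_nonneg _

theorem FormGE.of_eigenvaluesIn {d : ℕ} {m : ℝ} {I : Set ℝ} {M : Matrix (Fin d) (Fin d) ℝ}
    (hM : M.IsSymm) (h : EigenvaluesIn M I) (hI : I ⊆ Set.Ici (-m)) : FormGE (-m) M := by
  have hP : (M + m • (1 : Matrix (Fin d) (Fin d) ℝ)).IsHermitian := by
    rw [IsHermitian, conjTranspose_eq_transpose_of_trivial]
    exact isSymm_add_smul_one hM m
  have hpos : (M + m • (1 : Matrix (Fin d) (Fin d) ℝ)).PosSemidef := by
    rw [hP.posSemidef_iff_eigenvalues_nonneg]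
    intro i
    have h1 := hP.mulVec_eigenvectorBasis i
    set w : Fin d → ℝ := ⇑(hP.eigenvectorBasis i) with hw
    have hw0 : w ≠ 0 := by
      intro h0
      exact hP.eigenvectorBasis.toBasis.ne_zero i (by
        ext j
        simpa using congrFun h0 j)
    have h2 : M *ᵥ w = (hP.eigenvalues i - m) • w := by
      rw [add_mulVec, smul_mulVec, one_mulVec] at h1
      rw [sub_smul, ← h1, add_sub_cancel_right]
    have h3 := hI (h (hP.eigenvalues i - m) (Module.End.hasEigenvalue_of_hasEigenvector (x := w)
      ⟨Module.End.mem_eigenspace_iff.2 (by rw [toLin'_apply, h2]), hw0⟩))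
    simp only [Set.mem_Ici] at h3
    simp only [Pi.zero_apply]
    linarith
  intro v
  have := hpos.dotProduct_mulVec_nonneg v
  simp only [star_trivial, add_mulVec, smul_mulVec, one_mulVec, dotProduct_add, dotProduct_smul,
    smul_eq_mul] at this
  linarith

/-- For a `Q`-tensor, a lower bound on the quadratic form confines all eigenvalues, since the trace
vanishes. -/
theorem FormGE.eigenvaluesIn {d : ℕ} {m : ℝ} {M : Matrix (Fin d) (Fin d) ℝ} (hm : 0 ≤ m)
    (hM : IsQTensor M) (h : FormGE (-m) M) : EigenvaluesIn M (Set.Icc (-m) ((d - 1) * m)) := by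
  intro μ hμ
  obtain ⟨v, hv⟩ := hμ.exists_hasEigenvector
  have hv1 : M *ᵥ v = μ • v := by simpa using hv.apply_eq_smul
  have hpos : 0 < v ⬝ᵥ v := (zero_le_dotProduct_self v).lt_of_ne fun h0 =>
    hv.2 (dotProduct_self_eq_zero.1 h0.symm)
  constructor
  · have := h v
    rw [hv1, dotProduct_smul, smul_eq_mul] at this
    exact le_of_mul_le_mul_right this hpos
  · have h1 := trace_mul_self_le_sq_trace (isSymm_add_smul_one hM.1 m) h.add_smul_one
    have h2 := dotProduct_mulVec_self_le (isSymm_add_smul_one hM.1 m) v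
    have h3 : (M + m • (1 : Matrix (Fin d) (Fin d) ℝ)) *ᵥ v = (μ + m) • v := by
      rw [add_mulVec, hv1, smul_mulVec, one_mulVec, add_smul]
    rw [h3, smul_dotProduct, dotProduct_smul, smul_eq_mul, smul_eq_mul, ← mul_assoc] at h2
    have h4 := le_of_mul_le_mul_right h2 hpos
    rw [trace_add (A := M), hM.2, trace_smul, trace_one, Fintype.card_fin, smul_eq_mul,
      zero_add] at h1
    have h5 : μ + m ≤ m * d := abs_le_of_sq_le_sq' (by nlinarith) (by positivity) |>.2
    linarith

theorem dotProduct_bulkTerm_mulVec {d : ℕ} (C : Coefficients) {M : Matrix (Fin d) (Fin d) ℝ}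
    (hs : M.IsSymm) {v : Fin d → ℝ} (hv : v ⬝ᵥ v = 1) :
    v ⬝ᵥ (bulkTerm C M *ᵥ v) = -C.a * (v ⬝ᵥ (M *ᵥ v))
      + C.b * ((M *ᵥ v) ⬝ᵥ (M *ᵥ v) - (M * M).trace / d)
      - C.c * (M * M).trace * (v ⬝ᵥ (M *ᵥ v)) := by
  simp only [bulkTerm, sub_mulVec, add_mulVec, neg_mulVec, smul_mulVec, one_mulVec, dotProduct_sub,
    dotProduct_add, dotProduct_neg, dotProduct_smul, smul_eq_mul, hv, dotProduct_mul_mulVec hs]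
  ring

/-- In dimension three, the shifted reaction term `Λ Q + f(Q)` maps the convex set `{-m ≤ Q}`
to `{-Λ m ≤ Q}`, up to an error linear in the amount `δ` by which `Q` leaves the set. Since
`|Q v|² ≥ (v · Q v)²` for unit vectors, the form of `Λ Q + f(Q)` at `v` is at least a
quadratic polynomial in `v · Q v`, increasing for large `Λ`; at `-m` the bound
`tr Q² ≤ 6 m²` and the choice of `m` as a zero of `a - b m + 6 c m²` conclude. -/
theorem reaction_lower_bound_three (C : Coefficients) (hb : 0 ≤ C.b) (hc : 0 < C.c) {m R : ℝ}
    (hm : 0 ≤ m) (hmb : C.c * m ≤ C.b / 3) (hroot : C.a - C.b * m + 6 * C.c * m ^ 2 = 0)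
    {Λ : ℝ} (hΛ : |C.a| + 2 * C.b * (m + R) + 6 * C.c * (m + R) ^ 2 ≤ Λ) {δ : ℝ}
    (hδ : δ ∈ Set.Icc 0 R) {M : Matrix (Fin 3) (Fin 3) ℝ} (hM : IsQTensor M)
    (h : FormGE (-(m + δ)) M) {v : Fin 3 → ℝ} (hv : v ⬝ᵥ v = 1) :
    -(Λ * m) - (Λ + C.b * (m + R)) * δ ≤ Λ * (v ⬝ᵥ (M *ᵥ v)) + v ⬝ᵥ (bulkTerm C M *ᵥ v) := by
  have htr := hM.trace_mul_self_le h
  have htr0 := hM.1.trace_mul_self_nonneg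
  have hq := h v
  have hq2 := sq_dotProduct_mulVec_le M hv
  rw [dotProduct_bulkTerm_mulVec C hM.1 hv]
  rw [hv, mul_one] at hq
  generalize v ⬝ᵥ (M *ᵥ v) = q at *
  generalize (M *ᵥ v) ⬝ᵥ (M *ᵥ v) = p at *
  generalize (M * M).trace = τ at *
  obtain ⟨hδ0, hδR⟩ := hδ
  push_cast at *
  set m' := m + δ with hm'
  have hm'0 : 0 ≤ m' := by positivity
  have hm'R : m' ≤ m + R := by linarith
  have hτ : C.c * τ ≤ 6 * C.c * (m + R) ^ 2 := by nlinarith [pow_le_pow_left₀ hm'0 hm'R 2]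
  have hbm : C.b * m' ≤ C.b * (m + R) := mul_le_mul_of_nonneg_left hm'R hb
  have h1 : 0 ≤ Λ - C.a - C.c * τ + C.b * (q - m') := by
    nlinarith [le_abs_self C.a, mul_nonneg hb (by linarith : (0:ℝ) ≤ q + m')]
  have h2 := mul_nonneg (by linarith : (0:ℝ) ≤ q + m') h1
  have h3 : C.b * q ^ 2 ≤ C.b * p := mul_le_mul_of_nonneg_left hq2 hb
  have h4 : 6 * m' ^ 2 * (C.c * m - C.b / 3) ≤ τ * (C.c * m' - C.b / 3) := by
    have e1 : (C.b / 3 - C.c * m) * τ ≤ (C.b / 3 - C.c * m) * (6 * m' ^ 2) :=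
      mul_le_mul_of_nonneg_left (by linarith) (by linarith)
    have e2 : 0 ≤ C.c * δ * τ := by positivity
    rw [hm'] at *
    nlinarith
  have h5 : m' * C.a + C.b * m' ^ 2 + 6 * m' ^ 2 * (C.c * m - C.b / 3)
      = m' * δ * (6 * C.c * m - C.b) := by
    have : C.a = C.b * m - 6 * C.c * m ^ 2 := by linarith
    rw [this, hm']
    ring
  have h6 : -(C.b * (m + R) * δ) ≤ m' * δ * (6 * C.c * m - C.b) := by
    have e1 : 0 ≤ m' * δ * (6 * C.c * m) := by positivity
    nlinarith [mul_le_mul_of_nonneg_right hbm hδ0]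
  have h7 : Λ * m' = Λ * m + Λ * δ := by rw [hm']; ring
  nlinarith

/-- In dimension two the `b`-term vanishes on `Q`-tensors and the reaction term is a multiple of
`Q`, so that only the scalar function `λ ↦ (Λ - a) λ - 2 c λ³`, increasing for large `Λ`, has to be
bounded. -/
theorem reaction_lower_bound_two (C : Coefficients) (hc : 0 < C.c) {m R : ℝ}
    (hm : 0 ≤ m) (ham : 0 ≤ C.a + 2 * C.c * m ^ 2)
    {Λ : ℝ} (hΛ : |C.a| + 6 * C.c * (m + R) ^ 2 ≤ Λ) {δ : ℝ}
    (hδ : δ ∈ Set.Icc 0 R) {M : Matrix (Fin 2) (Fin 2) ℝ} (hM : IsQTensor M)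
    (h : FormGE (-(m + δ)) M) {v : Fin 2 → ℝ} (hv : v ⬝ᵥ v = 1) :
    -(Λ * m) - Λ * δ ≤ Λ * (v ⬝ᵥ (M *ᵥ v)) + v ⬝ᵥ (bulkTerm C M *ᵥ v) := by
  have htr := hM.trace_mul_self_le h
  have htr0 := hM.1.trace_mul_self_nonneg
  have hq2 := sq_dotProduct_mulVec_le M hv
  have hp : (M *ᵥ v) ⬝ᵥ (M *ᵥ v) = (M * M).trace / 2 := by
    have h10 : M 1 0 = M 0 1 := hM.1.apply 0 1
    have h11 : M 1 1 = -M 0 0 := by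
      have := hM.2
      rw [trace_fin_two] at this
      linarith
    have hv' : v 0 * v 0 + v 1 * v 1 = 1 := by simpa [dotProduct, Fin.sum_univ_two] using hv
    simp only [trace_fin_two, mul_apply, dotProduct, mulVec, Fin.sum_univ_two, h10, h11]
    linear_combination (M 0 0 ^ 2 + M 0 1 ^ 2) * hv'
  rw [dotProduct_bulkTerm_mulVec C hM.1 hv, hp]
  rw [hp] at hq2
  generalize v ⬝ᵥ (M *ᵥ v) = q at *
  generalize (M * M).trace = τ at *
  obtain ⟨hδ0, hδR⟩ := hδ
  push_cast at *
  obtain ⟨l, hl0, hl⟩ : ∃ l : ℝ, 0 ≤ l ∧ τ = 2 * l ^ 2 :=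
    ⟨Real.sqrt (τ / 2), Real.sqrt_nonneg _, by rw [Real.sq_sqrt (by positivity)]; ring⟩
  subst hl
  have hm'0 : 0 ≤ m + δ := by positivity
  have hlm : l ≤ m + δ := abs_le_of_sq_le_sq' (by linarith) hm'0 |>.2
  have hql : -l ≤ q := (abs_le_of_sq_le_sq' (by linarith) hl0).1
  have hsq : (m + δ) ^ 2 ≤ (m + R) ^ 2 := pow_le_pow_left₀ hm'0 (by linarith) 2
  have ha := le_abs_self C.a
  have e1 : l ^ 2 ≤ (m + δ) ^ 2 := pow_le_pow_left₀ hl0 hlm 2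
  have e2 : (m + δ) * l ≤ (m + δ) ^ 2 := by nlinarith
  have h1 : 0 ≤ Λ - C.a - 2 * C.c * ((m + δ) ^ 2 + (m + δ) * l + l ^ 2) := by
    nlinarith
  have h2 : 0 ≤ Λ - C.a - 2 * C.c * l ^ 2 := by
    nlinarith [mul_nonneg hc.le (mul_nonneg hm'0 hl0), mul_nonneg hc.le (sq_nonneg (m + δ))]
  have h3 := mul_nonneg (sub_nonneg.2 hlm) h1
  have h4 := mul_nonneg (by linarith : (0:ℝ) ≤ q + l) h2
  have h5 : 0 ≤ (m + δ) * (C.a + 2 * C.c * (m + δ) ^ 2) := by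
    refine mul_nonneg hm'0 ?_
    have : m ^ 2 ≤ (m + δ) ^ 2 := pow_le_pow_left₀ hm (by linarith) 2
    nlinarith
  nlinarith

/-! ### The equation for the quadratic form -/

theorem dotProduct_mulVec_eq_sum {d : ℕ} (M : Matrix (Fin d) (Fin d) ℝ) (v : Fin d → ℝ) :
    v ⬝ᵥ (M *ᵥ v) = ∑ i, ∑ j, v i * v j * M i j := by
  simp only [dotProduct, mulVec, Finset.mul_sum]
  exact Finset.sum_congr rfl fun i _ => Finset.sum_congr rfl fun j _ => by ring

theorem integral_dotProduct_mulVec_mul {d : ℕ} {F : Space d → Matrix (Fin d) (Fin d) ℝ}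
    (hF : Continuous F) {φ : Space d → ℝ} (hφ : IsTestFunction φ) (v : Fin d → ℝ) :
    ∫ x, (v ⬝ᵥ (F x *ᵥ v)) * φ x = ∑ i, ∑ j, v i * v j * ∫ x, F x i j * φ x := by
  have hint : ∀ i j, Integrable fun x => v i * v j * (F x i j * φ x) := fun i j =>
    (hφ.integrable_mul (hF.matrix_elem i j)).const_mul _
  simp_rw [dotProduct_mulVec_eq_sum, Finset.sum_mul, mul_assoc (_ * _)]
  rw [integral_finsetSum _ fun i _ => integrable_finsetSum _ fun j _ => hint i j]
  refine Finset.sum_congr rfl fun i _ => ?_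
  rw [integral_finsetSum _ fun j _ => hint i j]
  exact Finset.sum_congr rfl fun j _ => integral_const_mul _ _

theorem continuous_bulkTerm {d : ℕ} (C : Coefficients) :
    Continuous (bulkTerm C : Matrix (Fin d) (Fin d) ℝ → Matrix (Fin d) (Fin d) ℝ) := by
  unfold bulkTerm
  fun_prop

/-- In dimension two, on `Q`-tensors, the linear elastic part is a multiple of the Laplacian. -/
theorem linearElasticPairing_two (C : Coefficients) {q : Space 2 → Matrix (Fin 2) (Fin 2) ℝ}
    {x : Space 2} (hq : IsQTensor (q x)) (i j : Fin 2) {φ : Space 2 → ℝ} (hφ : IsTestFunction φ) :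
    linearElasticPairing C q i j φ x =
      (2 * C.L₁ + (C.L₂ + C.L₃)) * q x i j * laplAt φ x := by
  have h10 : q x 1 0 = q x 0 1 := hq.1.apply 0 1
  have h11 : q x 1 1 = -q x 0 0 := by
    have := hq.2
    rw [trace_fin_two] at this
    linarith
  have hsymm := hφ.pderivAt_comm 1 0 x
  fin_cases i <;> fin_cases j <;>
    simp [linearElasticPairing, laplAt, Fin.sum_univ_two, h10, h11, hsymm] <;> ring

theorem linearElasticPairing_of_add_eq_zero {d : ℕ} {C : Coefficients} (hC : C.L₂ + C.L₃ = 0)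
    (q : Space d → Matrix (Fin d) (Fin d) ℝ) (x : Space d) (i j : Fin d) (φ : Space d → ℝ) :
    linearElasticPairing C q i j φ x = 2 * C.L₁ * q x i j * laplAt φ x := by
  simp [linearElasticPairing, laplAt, hC]

/-- The quadratic form of the solution at a fixed vector solves a scalar heat equation with source,
when the linear elastic part is `ν` times the Laplacian. -/
theorem IsSolution.dotProduct_equation {d : ℕ} {C : Coefficients} {k T ν : ℝ}
    {Q₀ : Space d → Matrix (Fin d) (Fin d) ℝ} {Q : ℝ → Space d → Matrix (Fin d) (Fin d) ℝ}
    (hQ : IsSolution C k T Q₀ Q) (hL : C.L₄ = 0)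
    (hlin : ∀ (q : Space d → Matrix (Fin d) (Fin d) ℝ) (x : Space d), IsQTensor (q x) →
      ∀ i j, ∀ φ : Space d → ℝ, IsTestFunction φ →
        linearElasticPairing C q i j φ x = ν * q x i j * laplAt φ x)
    (hcont : ContinuousOn (fun p : ℝ × Space d => Q p.1 p.2) (Set.Icc 0 T ×ˢ Set.univ))
    (v : Fin d → ℝ) {φ : Space d → ℝ} (hφ : IsTestFunction φ) {t : ℝ} (ht : t ∈ Set.Icc 0 T) :
    (∫ x, (v ⬝ᵥ (Q t x *ᵥ v)) * φ x) - ∫ x, (v ⬝ᵥ (Q 0 x *ᵥ v)) * φ x =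
      ∫ s in (0 : ℝ)..t, ((∫ x, ν * (v ⬝ᵥ (Q s x *ᵥ v)) * laplAt φ x)
        + ∫ x, (v ⬝ᵥ (bulkTerm C (Q s x) *ᵥ v)) * φ x) := by
  obtain ⟨D, -, hD⟩ := hQ.equation
  have hsub : Set.uIcc 0 t ⊆ Set.Icc 0 T := by
    rw [Set.uIcc_of_le ht.1]
    exact Set.Icc_subset_Icc_right ht.2
  have h0 : (0 : ℝ) ∈ Set.Icc 0 T := ⟨le_rfl, ht.1.trans ht.2⟩
  have hbulk : ∀ s ∈ Set.Icc 0 T, Continuous fun x => bulkTerm C (Q s x) := fun s hs =>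
    (continuous_bulkTerm C).comp (hQ.continuous_space s hs)
  set G : Fin d → Fin d → ℝ → ℝ := fun i j s =>
    (∫ x, ν * Q s x i j * laplAt φ x) + ∫ x, bulkTerm C (Q s x) i j * φ x with hG
  have helem : ∀ i j, Continuous fun M : Matrix (Fin d) (Fin d) ℝ => M i j := fun i j =>
    continuous_id.matrix_elem i j
  have hGint : ∀ i j, IntervalIntegrable (G i j) volume 0 t := by
    intro i j
    refine ContinuousOn.intervalIntegrable (ContinuousOn.mono ?_ hsub)
    refine ContinuousOn.add
      (continuousOn_integral_mul_of_isTestFunction (w := fun s x => ν * Q s x i j)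
        (continuousOn_const.mul ((helem i j).comp_continuousOn hcont)) hφ.laplAt)
      (continuousOn_integral_mul_of_isTestFunction (w := fun s x => bulkTerm C (Q s x) i j)
        (((helem i j).comp (continuous_bulkTerm C)).comp_continuousOn hcont) hφ)
  have hE : ∀ i j, (∫ x, Q t x i j * φ x) - (∫ x, Q 0 x i j * φ x) =
      ∫ s in (0 : ℝ)..t, G i j s := by
    intro i j
    have h := hD i j φ hφ t ht
    simp_rw [← hQ.initial] at h
    rw [h]
    refine intervalIntegral.integral_congr fun s hs => ?_
    have hs' := hsub hs
    have hQs := hQ.continuous_space s hs'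
    simp only [hG]
    rw [← integral_add (hφ.laplAt.integrable_mul (f := fun x => ν * Q s x i j)
      (continuous_const.mul (hQs.matrix_elem i j)))
      (hφ.integrable_mul ((hbulk s hs').matrix_elem i j))]
    congr 1
    ext x
    rw [hlin (Q s) x (hQ.qTensor s hs' x) i j φ hφ]
    simp [cubicElasticPairing, hL]
  have hR : ∀ s ∈ Set.uIcc 0 t, ((∫ x, ν * (v ⬝ᵥ (Q s x *ᵥ v)) * laplAt φ x)
      + ∫ x, (v ⬝ᵥ (bulkTerm C (Q s x) *ᵥ v)) * φ x) = ∑ i, ∑ j, v i * v j * G i j s := by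
    intro s hs
    have hs' := hsub hs
    rw [integral_dotProduct_mulVec_mul (hbulk s hs') hφ]
    simp_rw [mul_assoc ν]
    rw [integral_const_mul, integral_dotProduct_mulVec_mul (hQ.continuous_space s hs') hφ.laplAt]
    simp only [hG, mul_add, Finset.sum_add_distrib, Finset.mul_sum, mul_assoc ν,
      integral_const_mul]
    congr 1
    exact Finset.sum_congr rfl fun i _ => Finset.sum_congr rfl fun j _ => by ring
  rw [intervalIntegral.integral_congr hR,
    intervalIntegral.integral_finsetSum fun i _ => ?_,
    integral_dotProduct_mulVec_mul (hQ.continuous_space t ht) hφ,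
    integral_dotProduct_mulVec_mul (hQ.continuous_space 0 h0) hφ, ← Finset.sum_sub_distrib]
  · refine Finset.sum_congr rfl fun i _ => ?_
    rw [intervalIntegral.integral_finsetSum fun j _ => (hGint i j).const_mul _,
      ← Finset.sum_sub_distrib]
    refine Finset.sum_congr rfl fun j _ => ?_
    rw [intervalIntegral.integral_const_mul, ← hE, mul_sub]
  · have := IntervalIntegrable.sum Finset.univ
      (fun j (_ : j ∈ Finset.univ) => (hGint i j).const_mul (v i * v j))
    rwa [Finset.sum_fn] at this

/-! ### Invariance of the convex set -/

open Set Filter Topology in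
/-- The convex set `{-m ≤ Q}` is invariant under a flow whose second order part is a multiple of the
Laplacian and whose reaction term satisfies the quantitative inward-pointing condition `hreact`:
the defect of the solution, at most `R e^{2Γt}`, can be halved indefinitely. -/
theorem IsSolution.formGE {d : ℕ} {C : Coefficients} {k T ν m : ℝ}
    {Q₀ : Space d → Matrix (Fin d) (Fin d) ℝ} {Q : ℝ → Space d → Matrix (Fin d) (Fin d) ℝ}
    (hQ : IsSolution C k T Q₀ Q) (hk : (d : ℝ) / 2 < k) (hν : 0 ≤ ν) (hm : 0 ≤ m) (hL : C.L₄ = 0)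
    (hlin : ∀ (q : Space d → Matrix (Fin d) (Fin d) ℝ) (x : Space d), IsQTensor (q x) →
      ∀ i j, ∀ φ : Space d → ℝ, IsTestFunction φ →
        linearElasticPairing C q i j φ x = ν * q x i j * laplAt φ x)
    (hreact : ∀ R : ℝ, 0 ≤ R → ∃ Λ Γ : ℝ, 0 < Λ ∧ 0 ≤ Γ ∧ ∀ δ ∈ Icc 0 R,
      ∀ M : Matrix (Fin d) (Fin d) ℝ, IsQTensor M → FormGE (-(m + δ)) M →
        ∀ v : Fin d → ℝ, v ⬝ᵥ v = 1 →
          -(Λ * m) - Γ * δ ≤ Λ * (v ⬝ᵥ (M *ᵥ v)) + v ⬝ᵥ (bulkTerm C M *ᵥ v))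
    (hQ₀ : ∀ x, FormGE (-m) (Q₀ x)) :
    ∀ t ∈ Icc 0 T, ∀ x, FormGE (-m) (Q t x) := by
  have hmod := fun i j => (hQ.sobolev i j).exists_modulus hk
    fun t ht => (hQ.continuous_space t ht).matrix_elem i j
  have hcont : ContinuousOn (fun p : ℝ × Space d => Q p.1 p.2) (Icc 0 T ×ˢ univ) := by
    refine continuousOn_pi.2 fun i => continuousOn_pi.2 fun j => ?_
    exact continuousOn_uncurry_of_uniform (u := fun t x => Q t x i j) (hmod i j).1
      fun t ht => (hQ.continuous_space t ht).matrix_elem i j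
  choose B hB using fun i j => (hmod i j).2
  set S : ℝ := ∑ i, ∑ j, B i j ^ 2 with hS
  have hS0 : 0 ≤ S := Finset.sum_nonneg fun i _ => Finset.sum_nonneg fun j _ => sq_nonneg _
  set R : ℝ := S + 1 with hR
  have hform : ∀ t ∈ Icc 0 T, ∀ x, ∀ v : Fin d → ℝ, v ⬝ᵥ v = 1 → -R ≤ v ⬝ᵥ (Q t x *ᵥ v) := by
    intro t ht x v hv
    have hs := (hQ.qTensor t ht x).1
    have h1 : (Q t x * Q t x).trace ≤ S := by
      simp only [trace, diag_apply, mul_apply, hS]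
      refine Finset.sum_le_sum fun i _ => Finset.sum_le_sum fun j _ => ?_
      rw [hs.apply i j, ← sq]
      exact sq_le_sq' (neg_le_of_abs_le (hB i j t ht x)) (le_of_abs_le (hB i j t ht x))
    have h2 := (sq_dotProduct_mulVec_le (Q t x) hv).trans (dotProduct_mulVec_self_le hs v)
    rw [hv, mul_one] at h2
    exact (abs_le_of_sq_le_sq' (by nlinarith) (by positivity)).1
  obtain ⟨Λ, Γ, hΛ, hΓ, hreact⟩ := hreact R (by positivity)
  have hiter : ∀ n : ℕ, ∀ t ∈ Icc 0 T, ∀ x,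
      FormGE (-(m + R / 2 ^ n * Real.exp (2 * Γ * t))) (Q t x) := by
    intro n
    induction n with
    | zero =>
      intro t ht x
      refine FormGE.of_dotProduct_self_eq_one fun v hv => ?_
      have h1 := hform t ht x v hv
      have h2 : 1 ≤ Real.exp (2 * Γ * t) := Real.one_le_exp (by have := ht.1; positivity)
      have h3 : R * 1 ≤ R * Real.exp (2 * Γ * t) := mul_le_mul_of_nonneg_left h2 (by positivity)
      rw [pow_zero, div_one]
      linarith
    | succ n ih =>
      intro t ht x
      refine FormGE.of_dotProduct_self_eq_one fun v hv => ?_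
      rw [show R / 2 ^ (n + 1) = R / 2 ^ n / 2 by rw [pow_succ]; ring]
      have hvM : Continuous fun M : Matrix (Fin d) (Fin d) ℝ => v ⬝ᵥ (M *ᵥ v) := by fun_prop
      refine lower_bound_improvement (T := T) (R := R) hν hΛ (by positivity) hm
        (w := fun t x => v ⬝ᵥ (Q t x *ᵥ v)) (r := fun t x => v ⬝ᵥ (bulkTerm C (Q t x) *ᵥ v))
        (hvM.comp_continuousOn hcont)
        ((hvM.comp (continuous_bulkTerm C)).comp_continuousOn hcont)
        (fun s hs y => hform s hs y v hv)
        (fun φ hφ s hs => hQ.dotProduct_equation hL hlin hcont v hφ hs) ?_ ?_ t ht x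
      · intro y
        have := hQ₀ y v
        rw [hv, mul_one, ← hQ.initial] at this
        exact this
      · intro s hs y
        -- the reaction bound is used with the defect truncated at the a priori bound `R`
        set E : ℝ := R / 2 ^ n * Real.exp (2 * Γ * s) with hE
        have hE0 : 0 ≤ E := by positivity
        have h1 := hreact (min E R) ⟨le_min hE0 (by positivity), min_le_right _ _⟩ (Q s y)
          (hQ.qTensor s hs y) (FormGE.of_dotProduct_self_eq_one fun u hu => by
            rcases min_cases E R with h | h
            · have := ih s hs y u
              rw [hu, mul_one] at this
              rw [h.1]
              exact this
            · rw [h.1]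
              linarith [hform s hs y u hu]) v hv
        have h2 : Γ * min E R ≤ Γ * E := mul_le_mul_of_nonneg_left (min_le_left _ _) hΓ
        linarith
  intro t ht x v
  have hlim : Tendsto (fun n : ℕ => -(m + R / 2 ^ n * Real.exp (2 * Γ * t)) * (v ⬝ᵥ v)) atTop
      (𝓝 (-m * (v ⬝ᵥ v))) := by
    have h1 : Tendsto (fun n : ℕ => R * (1 / 2 : ℝ) ^ n) atTop (𝓝 (R * 0)) :=
      (tendsto_pow_atTop_nhds_zero_of_lt_one (by norm_num) (by norm_num)).const_mul R
    have h2 := (((h1.mul_const (Real.exp (2 * Γ * t))).const_add m).neg).mul_const (v ⬝ᵥ v)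
    simp only [mul_zero, zero_mul, add_zero] at h2
    refine h2.congr fun n => ?_
    rw [one_div, inv_pow, div_eq_mul_inv]
  exact le_of_tendsto' hlim fun n => hiter n t ht x v

end

theorem proposition2p5 (d : ℕ) (C : Coefficients) (hb : 0 ≤ C.b) (hc : 0 < C.c)
    (k : ℝ) (hk : (d : ℝ) / 2 < k) (T : ℝ) (hT : 0 < T)
    (Q₀ : Space d → Matrix (Fin d) (Fin d) ℝ)
    (Q : ℝ → Space d → Matrix (Fin d) (Fin d) ℝ)
    (hQ : IsSolution C k T Q₀ Q)
    (I : Set ℝ)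
    (hcase :
      (d = 2 ∧ C.L₁ ≠ 0 ∧ C.L₄ = 0 ∧ 0 < C.L₁ + C.L₂ ∧ 0 < C.L₁ + C.L₃ ∧
        I = Set.Icc (-Real.sqrt (|C.a| / (2 * C.c))) (Real.sqrt (|C.a| / (2 * C.c)))) ∨
      (d = 3 ∧ 0 < C.L₁ ∧ C.L₂ + C.L₃ = 0 ∧ C.L₄ = 0 ∧
        |C.a| < C.b ^ 2 / (3 * C.c) ∧ 0 ≤ C.b ^ 2 - 24 * C.a * C.c ∧
        I = Set.Icc (-((C.b + Real.sqrt (C.b ^ 2 - 24 * C.a * C.c)) / (12 * C.c)))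
          ((C.b + Real.sqrt (C.b ^ 2 - 24 * C.a * C.c)) / (6 * C.c))))
    (hQ₀ : ∀ x, EigenvaluesIn (Q₀ x) I) :
    ∀ t ∈ Set.Icc 0 T, ∀ x, EigenvaluesIn (Q t x) I := by
  have h0 : (0 : ℝ) ∈ Set.Icc 0 T := ⟨le_rfl, hT.le⟩
  have hsymm₀ : ∀ x, (Q₀ x).IsSymm := fun x => hQ.initial x ▸ (hQ.qTensor 0 h0 x).1
  rcases hcase with ⟨rfl, -, hL, h12, h13, rfl⟩ | ⟨rfl, h1, h23, hL, ha, hdisc, rfl⟩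
  · set m := Real.sqrt (|C.a| / (2 * C.c)) with hm
    have hm0 : 0 ≤ m := Real.sqrt_nonneg _
    have hmsq : 2 * C.c * m ^ 2 = |C.a| := by
      rw [hm, Real.sq_sqrt (by positivity)]
      field_simp
    have hflow := hQ.formGE (ν := 2 * C.L₁ + (C.L₂ + C.L₃)) hk (by linarith) hm0 hL
      (fun q x hq i j φ hφ => linearElasticPairing_two C hq i j hφ)
      (fun R hR => ⟨|C.a| + 6 * C.c * (m + R) ^ 2 + 1, |C.a| + 6 * C.c * (m + R) ^ 2 + 1,
        by positivity, by positivity, fun δ hδ M hM h v hv =>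
          reaction_lower_bound_two C hc hm0 (by linarith [neg_abs_le C.a]) (by linarith) hδ hM h hv⟩)
      (fun x => FormGE.of_eigenvaluesIn (hsymm₀ x) (hQ₀ x) Set.Icc_subset_Ici_self)
    intro t ht x
    convert (hflow t ht x).eigenvaluesIn hm0 (hQ.qTensor t ht x) using 2
    push_cast
    ring
  · set r := Real.sqrt (C.b ^ 2 - 24 * C.a * C.c) with hr
    have hr0 : 0 ≤ r := Real.sqrt_nonneg _
    have hrsq : r ^ 2 = C.b ^ 2 - 24 * C.a * C.c := Real.sq_sqrt hdisc
    set m := (C.b + r) / (12 * C.c) with hm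
    have hm0 : 0 ≤ m := by positivity
    have hcm : C.c * m = (C.b + r) / 12 := by
      rw [hm]
      field_simp
    have hmb : C.c * m ≤ C.b / 3 := by
      rw [lt_div_iff₀ (by positivity)] at ha
      have : r ≤ 3 * C.b := by
        refine (abs_le_of_sq_le_sq' ?_ (by positivity)).2
        nlinarith [mul_le_mul_of_nonneg_right (neg_abs_le C.a) hc.le]
      rw [hcm]
      linarith
    have hroot : C.a - C.b * m + 6 * C.c * m ^ 2 = 0 := by
      have : 12 * C.c * m = C.b + r := by linarith
      have h24 : 24 * C.c * (C.a - C.b * m + 6 * C.c * m ^ 2) = 0 := by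
        linear_combination (12 * C.c * m - C.b + r) * this + hrsq
      exact (mul_eq_zero.1 h24).resolve_left (by positivity)
    have hflow := hQ.formGE (ν := 2 * C.L₁) hk (by linarith) hm0 hL
      (fun q x _ i j φ _ => linearElasticPairing_of_add_eq_zero h23 q x i j φ)
      (fun R hR => ⟨|C.a| + 2 * C.b * (m + R) + 6 * C.c * (m + R) ^ 2 + 1,
        |C.a| + 2 * C.b * (m + R) + 6 * C.c * (m + R) ^ 2 + 1 + C.b * (m + R),
        by positivity, by positivity, fun δ hδ M hM h v hv =>
          reaction_lower_bound_three C hb hc hm0 hmb hroot (by linarith) hδ hM h hv⟩)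
      (fun x => FormGE.of_eigenvaluesIn (hsymm₀ x) (hQ₀ x) Set.Icc_subset_Ici_self)
    intro t ht x
    convert (hflow t ht x).eigenvaluesIn hm0 (hQ.qTensor t ht x) using 2
    rw [hm]
    push_cast
    field_simp
    ring
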